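/- Let $S$ be an irreducible (reduced) complex algebraic variety, and endow $S(\mathbb{C})$ with its usual topology and its sheaf $\mathcal{O}$ of holomorphic functions. Let $\mathcal{H}$ be a variation of pure Hodge structures of weight $-1$ over $S$: a local system $H_{\mathbb{Z}}$ of free $\mathbb{Z}$-modules of finite rank on $S(\mathbb{C})$, with a decreasing filtration $F^\bullet$ of the bundle $H_{\mathbb{Z}}\otimes\mathcal{O}$ (also denoted by $\mathcal{H}$) by holomorphic subbundles, satisfying Griffiths transversality and inducing a pure Hodge structure of weight $-1$ on every fiber $H_s$. For $s\in S(\mathbb{C})$ put $J(H_s)=H_{s,\mathbb{C}}/(F^0H_{s,\mathbb{C}}+H_{s,\mathbb{Z}})$, and let $\mathcal{J}(\mathcal{H})$ be the sheaf of holomorphic sections of the Jacobian fibration, i.e. of the maps $s\mapsto\nu(s)\in J(H_s)$ that lift locally to holomorphic sections of $\mathcal{H}$. Then the sequence of sheaves $$0\to H_{\mathbb{Z}}\to \mathcal{H}/F^0\mathcal{H}\to\mathcal{J}(\mathcal{H})\to 0$$ is exact. For a normal function $\nu\in H^0(S(\mathbb{C}),\mathcal{J}(\mathcal{H}))$, let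 its Hodge class $[\nu]\in H^1(S(\mathbb{C}),H_{\mathbb{Z}})$ be the image of $\nu$ under the connecting map of this sequence. Let $0\to H\to H'\to\mathbb{Z}\to 0$ be an extension of variations of mixed Hodge structures over $S$ (with $\mathbb{Z}$ constant of type $(0,0)$) that is attached to $\nu$: for every $s\in S(\mathbb{C})$ the class in $J(H_s)$ of the extension of mixed Hodge structures $0\to H_s\to H'_s\to\mathbb{Z}\to 0$ is $\nu(s)$. Here the class of such an extension is that of $\sigma-\varphi\in H_{s,\mathbb{C}}$, where $\sigma\in H'_{s,\mathbb{Z}}$ and $\varphi\in F^0H'_{s,\mathbb{C}}$ both map to $1$. Let $\delta:H^0(S(\mathbb{C}),\mathbb{Z})\to H^1(S(\mathbb{C}),H_{\mathbb{Z}})$ be the connecting map of the exact sequence of local systems $0\to H_{\mathbb{Z}}\to H'_{\mathbb{Z}}\to\mathbb{Z}\to 0$. Then $$[\nu]=\delta(1).$$ -/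

import Mathlib

open CategoryTheory AlgebraicGeometry TopologicalSpace Opposite
open scoped TensorProduct Topology

noncomputable section

namespace NormalFunctions

/-! ### Complex points of a scheme over `ℂ`, with their analytic structure -/

/-- The set `S(ℂ)` of complex points of a scheme `S` over `ℂ`. -/
def ComplexPoints (S : Over (Spec (CommRingCat.of ℂ))) : Type :=
  Over.mk (𝟙 (Spec (CommRingCat.of ℂ))) ⟶ S

variable {S : Over (Spec (CommRingCat.of ℂ))}

/-- The complex point `x` lies in the Zariski open subset `U`. -/
def ComplexPoints.LiesIn (x : ComplexPoints S) (U : S.left.Opens) : Prop :=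
  (⊤ : (Spec (CommRingCat.of ℂ)).Opens) ≤ x.left ⁻¹ᵁ U

open Classical in
/-- The value at complex points of a regular function `f` on the Zariski open subset `U`
(with the value `0` at the points that do not lie in `U`). -/
def evalAt (U : S.left.Opens) (f : Γ(S.left, U)) (x : ComplexPoints S) : ℂ :=
  if h : x.LiesIn U then
    (Scheme.ΓSpecIso (CommRingCat.of ℂ)).hom (Scheme.Hom.appLE x.left U ⊤ h f)
  else 0

/-- The usual (analytic) topology on `S(ℂ)`: the coarsest topology for which every Zariski open
subset is open and every regular function on it is continuous. -/
instance : TopologicalSpace (ComplexPoints S) :=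
  TopologicalSpace.generateFrom
    {A | ∃ (U : S.left.Opens) (f : Γ(S.left, U)) (W : Set ℂ),
      IsOpen W ∧ A = {x | x.LiesIn U ∧ evalAt U f x ∈ W}}

variable (S) in
/-- `S(ℂ)` with its usual topology, as an object of `TopCat`. -/
abbrev An : TopCat.{0} := TopCat.of (ComplexPoints S)

/-- A complex valued function on `S(ℂ)` is holomorphic at `x` if near `x` it is a convergent power
series in finitely many regular functions. (For `S` reduced and locally of finite type these
are the germs of sections of the structure sheaf of the complex analytic space `S(ℂ)`.) -/
def HolomorphicAt (h : An S → ℂ) (x : An S) : Prop :=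
  ∃ (U : S.left.Opens) (n : ℕ) (f : Fin n → Γ(S.left, U)) (g : (Fin n → ℂ) → ℂ),
    ComplexPoints.LiesIn x U ∧ AnalyticAt ℂ g (fun i => evalAt U (f i) x) ∧
      ∀ᶠ y in 𝓝 x, h y = g (fun i => evalAt U (f i) y)

/-- Holomorphic tangent vectors at `x`: the `ℂ`-linear derivations, with values in `ℂ`, of the ring
of functions that are holomorphic at `x`. (Such derivations only depend on germs.) -/
structure IsTangentVector (x : An S) (D : (An S → ℂ) → ℂ) : Prop where
  map_const : ∀ c : ℂ, D (fun _ => c) = 0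
  map_add : ∀ f g, HolomorphicAt f x → HolomorphicAt g x → D (f + g) = D f + D g
  leibniz : ∀ f g, HolomorphicAt f x → HolomorphicAt g x → D (f * g) = f x * D g + g x * D f

/-! ### Local systems and the associated flat holomorphic bundles -/

variable (S) in
/-- Sheaves of abelian groups on `S(ℂ)`, for the usual topology. -/
abbrev AbSheaf :=
  CategoryTheory.Sheaf (Opens.grothendieckTopology (An S)) AddCommGrpCat.{0}

/-- The stalk of a sheaf at a point. -/
abbrev Stalk (L : AbSheaf S) (x : An S) : Type :=
  TopCat.Presheaf.stalk (C := AddCommGrpCat.{0}) (X := An S) L.obj x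

/-- The germ of a section at a point. -/
abbrev germ (L : AbSheaf S) {U : Opens (An S)} (x : An S) (hx : x ∈ U)
    (e : L.obj.obj (op U)) : Stalk L x :=
  (TopCat.Presheaf.germ L.obj U x hx).hom e

/-- The map induced on stalks by a morphism of sheaves. -/
abbrev stalkMap {L L' : AbSheaf S} (φ : L ⟶ L') (x : An S) : Stalk L x →+ Stalk L' x :=
  ((TopCat.Presheaf.stalkFunctor AddCommGrpCat.{0} x).map φ.hom).hom

/-- `L` is a local system of free `ℤ`-modules of finite rank: locally there are finitely many
sections whose germs form a basis of the stalk at every point, i.e. an isomorphism of `L` with a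
constant sheaf `ℤ ^ r`. -/
def IsLocalSystem (L : AbSheaf S) : Prop :=
  ∀ x : An S, ∃ (V : Opens (An S)) (_ : x ∈ V) (r : ℕ) (e : Fin r → L.obj.obj (op V)),
    ∀ (y : An S) (hy : y ∈ V),
      LinearIndependent ℤ (fun j => germ L y hy (e j)) ∧
        Submodule.span ℤ (Set.range fun j => germ L y hy (e j)) = ⊤

/-- The complex vector space `ℂ ⊗ L_x`. -/
abbrev Fiber (L : AbSheaf S) (x : An S) : Type := ℂ ⊗[ℤ] Stalk L x

/-- The canonical map `L_x → ℂ ⊗ L_x`. -/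
def toFiber (L : AbSheaf S) (x : An S) : Stalk L x →+ Fiber L x :=
  (TensorProduct.mk ℤ ℂ (Stalk L x) 1).toAddMonoidHom

/-- The `ℂ`-linear map induced on fibers by a morphism of sheaves. -/
def fiberMap {L L' : AbSheaf S} (φ : L ⟶ L') (x : An S) : Fiber L x →ₗ[ℂ] Fiber L' x :=
  (stalkMap φ x).toIntLinearMap.baseChange ℂ

/-- Complex conjugation on `ℂ ⊗ L_x`. -/
def fiberConj (L : AbSheaf S) (x : An S) : Fiber L x →+ Fiber L x :=
  (LinearMap.rTensor (Stalk L x)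
    (starRingEnd ℂ).toAddMonoidHom.toIntLinearMap).toAddMonoidHom

/-- The finite combination `∑ f_j ⊗ e_j` of sections `e` of `L` over `V`, with coefficients the
functions `f`, as a function `y ↦ ∑ f_j(y) ⊗ e_{j,y} ∈ ℂ ⊗ L_y` on `V`. -/
def combination (L : AbSheaf S) {V : Opens (An S)} {n : ℕ} (f : Fin n → An S → ℂ)
    (e : Fin n → L.obj.obj (op V)) (y : V) : Fiber L y :=
  ∑ j, f j y ⊗ₜ[ℤ] germ L y.1 y.2 (e j)

/-- The holomorphic sections over `U` of the flat bundle `L ⊗ 𝒪`: functions that are locally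
finite sums of sections of `L` with holomorphic coefficients. -/
def IsHolomorphicSection (L : AbSheaf S) (U : Opens (An S)) (v : ∀ y : U, Fiber L y) : Prop :=
  ∀ x : U, ∃ (V : Opens (An S)) (_ : x.1 ∈ V) (hVU : V ≤ U) (n : ℕ) (f : Fin n → An S → ℂ)
    (e : Fin n → L.obj.obj (op V)),
    (∀ j, ∀ y ∈ V, HolomorphicAt (f j) y) ∧
      ∀ y : V, v ⟨y, hVU y.2⟩ = combination L f e y

/-- A decreasing filtration of the flat bundle `L ⊗ 𝒪` by holomorphic subbundles that satisfies
Griffiths transversality with respect to the flat connection `∇ (f ⊗ e) = df ⊗ e`. -/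
structure HodgeFiltration (L : AbSheaf S) where
  F : ℤ → ∀ x : An S, Submodule ℂ (Fiber L x)
  antitone : ∀ {p q : ℤ}, p ≤ q → ∀ x, F q x ≤ F p x
  subbundle : ∀ (p : ℤ) (x : An S), ∃ (V : Opens (An S)) (_ : x ∈ V) (r : ℕ)
    (v : Fin r → ∀ y : V, Fiber L y), (∀ i, IsHolomorphicSection L V (v i)) ∧
      ∀ y : V, LinearIndependent ℂ (fun i => v i y) ∧
        Submodule.span ℂ (Set.range fun i => v i y) = F p y
  transversality : ∀ (p : ℤ) (V : Opens (An S)) (n : ℕ) (f : Fin n → An S → ℂ)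
    (e : Fin n → L.obj.obj (op V)),
    (∀ j, ∀ y ∈ V, HolomorphicAt (f j) y) →
    (∀ y : V, combination L f e y ∈ F p y) →
    ∀ (x : V) (D : (An S → ℂ) → ℂ), IsTangentVector x.1 D →
      (∑ j, D (f j) ⊗ₜ[ℤ] germ L x.1 x.2 (e j) : Fiber L x) ∈ F (p - 1) x

/-! ### Variations of Hodge structures -/

/-- The filtration `F` of `ℂ ⊗ L_x` is finite and defines a pure Hodge structure of weight `w`
on `L_x`: one has `ℂ ⊗ L_x = F ^ p ⊕ conj (F ^ q)` whenever `p + q = w + 1`. -/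
structure IsPureHodgeStructure (w : ℤ) (L : AbSheaf S) (x : An S)
    (F : ℤ → Submodule ℂ (Fiber L x)) : Prop where
  exhaustive : ∃ a, F a = ⊤
  separated : ∃ b, F b = ⊥
  opposed : ∀ p q : ℤ, p + q = w + 1 →
    IsCompl (F p).toAddSubgroup ((F q).toAddSubgroup.map (fiberConj L x))

variable (S) in
/-- A variation of pure Hodge structures of weight `w` over `S`. -/
structure VHS (w : ℤ) where
  /-- The integral structure. -/
  L : AbSheaf S
  isLocalSystem : IsLocalSystem L
  hodge : HodgeFiltration L
  pure : ∀ x, IsPureHodgeStructure w L x (fun p => hodge.F p x)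

/-! ### Quotients of the flat bundle; the exponential sequence -/

/-- Given a subgroup `N x` of every fiber `ℂ ⊗ L_x`, the sections over `U` of the associated
quotient: the functions `x ↦ q x ∈ (ℂ ⊗ L_x) / N x` that lift locally to holomorphic sections of
`L ⊗ 𝒪`. -/
def IsQuotientSection (L : AbSheaf S) (N : ∀ x : An S, AddSubgroup (Fiber L x))
    (U : Opens (An S)) (q : ∀ y : U, Fiber L y ⧸ N y) : Prop :=
  ∀ x : U, ∃ (V : Opens (An S)) (_ : x.1 ∈ V) (hVU : V ≤ U) (v : ∀ y : V, Fiber L y),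
    IsHolomorphicSection L V v ∧ ∀ y : V, q ⟨y, hVU y.2⟩ = QuotientAddGroup.mk (v y)

lemma IsHolomorphicSection.restrict {L : AbSheaf S} {U V : Opens (An S)} (h : V ≤ U)
    {v : ∀ y : U, Fiber L y} (hv : IsHolomorphicSection L U v) :
    IsHolomorphicSection L V (fun y => v ⟨y, h y.2⟩) := by
  intro x
  obtain ⟨W, hx, hWU, n, f, e, hf, he⟩ := hv ⟨x, h x.2⟩
  refine ⟨W ⊓ V, ⟨hx, x.2⟩, inf_le_right, n, f,
    fun j => L.obj.map (homOfLE inf_le_left).op (e j), fun j y hy => hf j y hy.1, ?_⟩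
  intro y
  refine (he ⟨y, y.2.1⟩).trans ?_
  unfold combination
  refine Finset.sum_congr rfl fun j _ => ?_
  congr 1
  exact (TopCat.Presheaf.germ_res_apply L.obj (homOfLE inf_le_left) y.1 y.2 (e j)).symm

lemma HolomorphicAt.neg {h : An S → ℂ} {x : An S} (hh : HolomorphicAt h x) :
    HolomorphicAt (-h) x := by
  obtain ⟨U, n, f, g, hU, hg, he⟩ := hh
  exact ⟨U, n, f, -g, hU, hg.neg, he.mono fun y hy => by simp [hy]⟩

lemma IsHolomorphicSection.zero (L : AbSheaf S) (U : Opens (An S)) :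
    IsHolomorphicSection L U (fun _ => 0) := fun x =>
  ⟨U, x.2, le_rfl, 0, Fin.elim0, Fin.elim0, fun j => j.elim0, fun y => by simp [combination]⟩

lemma IsHolomorphicSection.neg {L : AbSheaf S} {U : Opens (An S)}
    {v : ∀ y : U, Fiber L y} (hv : IsHolomorphicSection L U v) :
    IsHolomorphicSection L U (fun y => -v y) := by
  intro x
  obtain ⟨V, hx, hVU, n, f, e, hf, he⟩ := hv x
  refine ⟨V, hx, hVU, n, fun j => -f j, e, fun j y hy => (hf j y hy).neg, fun y => ?_⟩
  simp only [he y, combination, Pi.neg_apply, TensorProduct.neg_tmul, Finset.sum_neg_distrib]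

lemma IsHolomorphicSection.add {L : AbSheaf S} {U : Opens (An S)}
    {v w : ∀ y : U, Fiber L y} (hv : IsHolomorphicSection L U v)
    (hw : IsHolomorphicSection L U w) :
    IsHolomorphicSection L U (fun y => v y + w y) := by
  intro x
  obtain ⟨V, hx, hVU, n, f, e, hf, he⟩ := hv x
  obtain ⟨V', hx', hVU', n', f', e', hf', he'⟩ := hw x
  refine ⟨V ⊓ V', ⟨hx, hx'⟩, inf_le_left.trans hVU, n + n', Fin.append f f',
    Fin.append (fun j => L.obj.map (homOfLE inf_le_left).op (e j))
      (fun j => L.obj.map (homOfLE inf_le_right).op (e' j)), ?_, ?_⟩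
  · intro j
    refine Fin.addCases (fun i y hy => ?_) (fun i y hy => ?_) j
    · rw [Fin.append_left]; exact hf i y hy.1
    · rw [Fin.append_right]; exact hf' i y hy.2
  · intro y
    have h1 := he ⟨y, y.2.1⟩
    have h2 := he' ⟨y, y.2.2⟩
    refine (congrArg₂ (· + ·) h1 h2).trans ?_
    unfold combination
    rw [Fin.sum_univ_add]
    simp only [Fin.append_left, Fin.append_right]
    congr 1
    · refine Finset.sum_congr rfl fun j _ => ?_
      congr 1
      exact (TopCat.Presheaf.germ_res_apply L.obj (homOfLE inf_le_left) y.1 y.2 (e j)).symm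
    · refine Finset.sum_congr rfl fun j _ => ?_
      congr 1
      exact (TopCat.Presheaf.germ_res_apply L.obj (homOfLE inf_le_right) y.1 y.2 (e' j)).symm

/-- The group of sections over `U` of the quotient of `L ⊗ 𝒪` by the family of subgroups `N`. -/
def quotientSections (L : AbSheaf S) (N : ∀ x : An S, AddSubgroup (Fiber L x))
    (U : Opens (An S)) : AddSubgroup (∀ y : U, Fiber L y ⧸ N y) where
  carrier := {q | IsQuotientSection L N U q}
  zero_mem' := fun x => ⟨U, x.2, le_rfl, fun _ => 0, IsHolomorphicSection.zero L U, fun _ => rfl⟩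
  add_mem' := by
    intro q q' hq hq' x
    obtain ⟨V, hx, hVU, v, hv, h⟩ := hq x
    obtain ⟨V', hx', hVU', v', hv', h'⟩ := hq' x
    refine ⟨V ⊓ V', ⟨hx, hx'⟩, inf_le_left.trans hVU, _,
      (hv.restrict inf_le_left).add (hv'.restrict inf_le_right), fun y => ?_⟩
    exact congrArg₂ (· + ·) (h ⟨y, y.2.1⟩) (h' ⟨y, y.2.2⟩)
  neg_mem' := by
    intro q hq x
    obtain ⟨V, hx, hVU, v, hv, h⟩ := hq x
    exact ⟨V, hx, hVU, _, hv.neg, fun y => congrArg Neg.neg (h y)⟩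

lemma IsQuotientSection.restrict {L : AbSheaf S} {N : ∀ x : An S, AddSubgroup (Fiber L x)}
    {U V : Opens (An S)} (h : V ≤ U) {q : ∀ y : U, Fiber L y ⧸ N y}
    (hq : IsQuotientSection L N U q) : IsQuotientSection L N V (fun y => q ⟨y, h y.2⟩) := by
  intro x
  obtain ⟨W, hx, hWU, v, hv, e⟩ := hq ⟨x, h x.2⟩
  exact ⟨W ⊓ V, ⟨hx, x.2⟩, inf_le_right, _, hv.restrict inf_le_left, fun y => e ⟨y, y.2.1⟩⟩

/-- The presheaf of sections of the quotient of `L ⊗ 𝒪` by the family of subgroups `N`. -/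
def quotientPresheaf (L : AbSheaf S) (N : ∀ x : An S, AddSubgroup (Fiber L x)) :
    TopCat.Presheaf AddCommGrpCat.{0} (An S) where
  obj U := AddCommGrpCat.of (quotientSections L N U.unop)
  map i := AddCommGrpCat.ofHom
    { toFun := fun q => ⟨fun y => q.1 ⟨y, i.unop.le y.2⟩, q.2.restrict i.unop.le⟩
      map_zero' := rfl
      map_add' := fun _ _ => rfl }
  map_id _ := rfl
  map_comp _ _ := rfl

/-- The same sections, as a sheaf of types. -/
def quotientPredicate (L : AbSheaf S) (N : ∀ x : An S, AddSubgroup (Fiber L x)) :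
    TopCat.LocalPredicate (X := An S) (fun x => Fiber L x ⧸ N x) where
  pred {U} q := IsQuotientSection L N U q
  res {U V} i q hq := hq.restrict i.le
  locality {U} q hq := by
    intro x
    obtain ⟨V, hx, i, h⟩ := hq x
    obtain ⟨W, hxW, hWV, v, hv, e⟩ := h ⟨x, hx⟩
    exact ⟨W, hxW, hWV.trans i.le, v, hv, e⟩

/-- The sheaf of sections of the quotient of `L ⊗ 𝒪` by the family of subgroups `N`. -/
def quotientSheaf (L : AbSheaf S) (N : ∀ x : An S, AddSubgroup (Fiber L x)) : AbSheaf S :=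
  ⟨quotientPresheaf L N,
    (TopCat.Presheaf.isSheaf_iff_isSheaf_comp (forget AddCommGrpCat.{0}) _).mpr
      (TopCat.Presheaf.isSheaf_of_iso
        (NatIso.ofComponents (fun _ => Iso.refl _) (fun _ => rfl))
        (TopCat.subpresheafToTypes.isSheaf (quotientPredicate L N)))⟩

/-- Enlarging the subgroups one divides by. -/
def quotientSheafMap (L : AbSheaf S) {N N' : ∀ x : An S, AddSubgroup (Fiber L x)}
    (h : ∀ x, N x ≤ N' x) : quotientSheaf L N ⟶ quotientSheaf L N' :=
  ⟨{ app := fun U => AddCommGrpCat.ofHom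
      { toFun := fun q => ⟨fun y => QuotientAddGroup.map (N y) (N' y) (AddMonoidHom.id _)
            ((h y).trans (AddSubgroup.comap_id _).ge) (q.1 y), fun x => by
          obtain ⟨V, hx, hVU, v, hv, e⟩ := q.2 x
          exact ⟨V, hx, hVU, v, hv, fun y => congrArg _ (e y)⟩⟩
        map_zero' := Subtype.ext (funext fun _ => map_zero _)
        map_add' := fun _ _ => Subtype.ext (funext fun _ => map_add _ _ _) }
     naturality := fun _ _ _ => rfl }⟩

lemma isHolomorphicSection_toFiber (L : AbSheaf S) (U : Opens (An S))
    (e : L.obj.obj (op U)) :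
    IsHolomorphicSection L U (fun y => toFiber L y (germ L y.1 y.2 e)) := fun x =>
  ⟨U, x.2, le_rfl, 1, fun _ _ => 1, fun _ => e,
    fun _ y _ => ⟨⊤, 0, Fin.elim0, fun _ => 1, le_top, analyticAt_const,
      Filter.Eventually.of_forall fun _ => rfl⟩,
    fun y => by simp [combination, toFiber]⟩

/-- The map from `L` to the quotient of `L ⊗ 𝒪` induced by the inclusion `L → L ⊗ 𝒪`. -/
def toQuotientSheaf (L : AbSheaf S) (N : ∀ x : An S, AddSubgroup (Fiber L x)) :
    L ⟶ quotientSheaf L N :=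
  ⟨{ app := fun U => AddCommGrpCat.ofHom
      { toFun := fun e => ⟨fun y => QuotientAddGroup.mk (toFiber L y (germ L y.1 y.2 e)),
          fun x => ⟨U.unop, x.2, le_rfl, _, isHolomorphicSection_toFiber L U.unop e,
            fun _ => rfl⟩⟩
        map_zero' := Subtype.ext (funext fun y => by simp)
        map_add' := fun a b => Subtype.ext (funext fun y => by simp) }
     naturality := fun U V i => by
      ext e
      refine Subtype.ext (funext fun y => ?_)
      exact congrArg (fun t => (QuotientAddGroup.mk (toFiber L y t) : Fiber L y ⧸ N y))
        (TopCat.Presheaf.germ_res_apply L.obj i.unop y.1 y.2 e) }⟩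

/-- The subgroup `F ^ 0` of the fiber at `x`. -/
def VHS.F0 {w : ℤ} (H : VHS S w) (x : An S) : AddSubgroup (Fiber H.L x) :=
  (H.hodge.F 0 x).toAddSubgroup

/-- The subgroup `F ^ 0 + H_ℤ` of the fiber at `x`. -/
def VHS.F0Lattice {w : ℤ} (H : VHS S w) (x : An S) : AddSubgroup (Fiber H.L x) :=
  H.F0 x ⊔ (toFiber H.L x).range

/-- The fiber at `x` of the Jacobian fibration: `J(H_x) = H_{x,ℂ} / (F ^ 0 + H_{x,ℤ})`. -/
abbrev VHS.Jacobian {w : ℤ} (H : VHS S w) (x : An S) : Type :=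
  Fiber H.L x ⧸ H.F0Lattice x

/-- The sheaf `ℋ / F ^ 0 ℋ`. -/
def VHS.modF0Sheaf {w : ℤ} (H : VHS S w) : AbSheaf S := quotientSheaf H.L H.F0

/-- The sheaf of holomorphic sections of the Jacobian fibration. -/
def VHS.jacobianSheaf {w : ℤ} (H : VHS S w) : AbSheaf S := quotientSheaf H.L H.F0Lattice

/-- The exponential sequence `H_ℤ → ℋ / F ^ 0 ℋ → 𝒥(ℋ)` of the Jacobian fibration. -/
def VHS.exponentialSequence {w : ℤ} (H : VHS S w) : ShortComplex (AbSheaf S) :=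
  ShortComplex.mk (X₁ := H.L) (X₂ := H.modF0Sheaf) (X₃ := H.jacobianSheaf)
    (toQuotientSheaf H.L H.F0)
    (quotientSheafMap H.L (N := H.F0) (N' := H.F0Lattice) fun _ => le_sup_left) (by
      refine CategoryTheory.Sheaf.hom_ext ?_
      ext U e
      refine Subtype.ext (funext fun y => ?_)
      exact (QuotientAddGroup.eq_zero_iff _).mpr
        ((le_sup_right : _ ≤ H.F0Lattice y) ⟨_, rfl⟩))

/-- Normal functions: the holomorphic sections over `S(ℂ)` of the Jacobian fibration. -/
abbrev VHS.NormalFunction {w : ℤ} (H : VHS S w) : Type :=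
  H.jacobianSheaf.obj.obj (op ⊤)

/-- The value of a normal function at a point. -/
def VHS.NormalFunction.value {w : ℤ} {H : VHS S w} (ν : H.NormalFunction) (x : An S) :
    H.Jacobian x :=
  (show quotientSections H.L H.F0Lattice ⊤ from ν).1 ⟨x, trivial⟩

/-! ### Sheaf cohomology -/

variable (S) in
/-- The constant sheaf `ℤ` on `S(ℂ)`. -/
abbrev constZ : AbSheaf S :=
  (constantSheaf (Opens.grothendieckTopology (An S)) AddCommGrpCat.{0}).obj
    (AddCommGrpCat.of (ULift ℤ))

variable (S) in
/-- The global section `1` of the constant sheaf `ℤ`. -/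
def constOne : (constZ S).obj.obj (op ⊤) :=
  ((toSheafify (Opens.grothendieckTopology (An S))
    ((Functor.const _).obj (AddCommGrpCat.of (ULift ℤ)))).app (op ⊤)).hom (ULift.up 1)

/-- The first cohomology group `H ^ 1 (S(ℂ), L)` of an abelian sheaf. -/
abbrev H1 (L : AbSheaf S) : Type := CategoryTheory.Sheaf.H L 1

/-- The connecting map `H ^ 0 (S(ℂ), C) → H ^ 1 (S(ℂ), A)` of the long exact cohomology sequence of
a short exact sequence `0 → A → B → C → 0` of abelian sheaves. -/
def connectingMap {T : ShortComplex (AbSheaf S)} (hT : T.ShortExact)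
    (s : T.X₃.obj.obj (op ⊤)) : H1 T.X₁ :=
  hT.extClass.postcomp (constZ S) (zero_add 1)
    (AddEquiv.symm (CategoryTheory.Sheaf.H.equiv₀ (J := Opens.grothendieckTopology (An S))
      T.X₃ (T := (⊤ : Opens (An S))) Limits.isTerminalTop) s)

/-! ### Extensions of variations of mixed Hodge structures -/

/-- Extensions `0 → H → H' → ℤ → 0` of variations of mixed Hodge structures, where `H` is pure of
weight `-1` and `ℤ` is the constant variation of type `(0,0)`. The weight filtration of `H'` is
then `W_{-1} = H`, `W_0 = H'`; `H'` is a variation of mixed Hodge structures and the sequence is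
exact precisely if the underlying sequence of local systems is exact and the Hodge
filtration of `H'` induces those of `H` and of `ℤ`. -/
structure VHS.MixedExtension (H : VHS S (-1)) where
  /-- The integral local system of `H'`. -/
  L : AbSheaf S
  isLocalSystem : IsLocalSystem L
  hodge : HodgeFiltration L
  incl : H.L ⟶ L
  proj : L ⟶ constZ S
  zero : incl ≫ proj = 0
  shortExact : (ShortComplex.mk incl proj zero).ShortExact
  filtration_sub : ∀ (p : ℤ) (x : An S),
    (hodge.F p x).comap (fiberMap incl x) = H.hodge.F p x
  filtration_quot : ∀ (p : ℤ) (x : An S),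
    (hodge.F p x).map (fiberMap proj x) = if p ≤ 0 then ⊤ else ⊥

/-- The class in `J(H_x)` of the extension of mixed Hodge structures `0 → H_x → H'_x → ℤ → 0` is
`c`. The class is that of `α = σ - φ ∈ H_{x,ℂ}` in `H_{x,ℂ} / (F ^ 0 + H_{x,ℤ})`, where `σ` is an
integral lift of `1`, and `φ` a lift of `1` in `F ^ 0`; it does not depend on `σ` and `φ`. (This is
the sign for which the connecting maps of the exponential sequence and of the extension agree;
with `φ - σ` in place of `σ - φ` they differ by a sign.) -/
def VHS.MixedExtension.HasClass {H : VHS S (-1)} (E : H.MixedExtension) (x : An S)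
    (c : H.Jacobian x) : Prop :=
  ∃ (σ : Stalk E.L x) (α : Fiber H.L x),
    stalkMap E.proj x σ = germ (constZ S) (U := ⊤) x trivial (constOne S) ∧
      toFiber E.L x σ - fiberMap E.incl x α ∈ E.hodge.F 0 x ∧ c = QuotientAddGroup.mk α

/-- `E` is the extension attached to the normal function `ν`: at every point `x` its class in
`J(H_x)` is the value of `ν`. -/
def VHS.MixedExtension.IsAttachedTo {H : VHS S (-1)} (E : H.MixedExtension)
    (ν : H.NormalFunction) : Prop :=
  ∀ x : An S, E.HasClass x (ν.value x)

/-- The Hodge class of a normal function: its image under the connecting map of the exponential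
sequence. -/
def VHS.hodgeClass (H : VHS S (-1)) (hexp : H.exponentialSequence.ShortExact)
    (ν : H.NormalFunction) : H1 H.L :=
  connectingMap hexp ν

/-- The image `δ(1)` of `1 ∈ H ^ 0 (S(ℂ), ℤ)` under the connecting map of the sequence of local
systems that underlies an extension. -/
def VHS.MixedExtension.deltaOne {H : VHS S (-1)} (E : H.MixedExtension) : H1 H.L :=
  connectingMap E.shortExact (constOne S)

end NormalFunctions

end

/-! Both classes come from connecting maps, so it is enough to exhibit a morphism of short exact
sequences from `0 → H_ℤ → H'_ℤ → ℤ → 0` to the exponential sequence that is the identity on `H_ℤ`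
and sends `1` to `ν`; `connectingMap_naturality` then gives the equality.

The middle component is the composite `H'_ℤ → ℋ'/F⁰ℋ' ≅ ℋ/F⁰ℋ`. The isomorphism holds because `F⁰H'`
surjects onto `ℂ` and meets `ℋ` in `F⁰ℋ`. It is handled through the relation `Represents`:
representatives `α` of `s` exist and can be chosen locally holomorphic (`exists_represents`), and
they are unique modulo `F⁰` (`Represents.sub_mem`). On `H_ℤ` this map is the inclusion of the
exponential sequence, so it descends to `ℤ → 𝒥(ℋ)`. A lift `σ` of `1` is sent to the class of `σ -
φ`, which is the extension class, hence to the value of `ν` (`toJacobianSheaf_constOne`).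

The other half is exactness of the exponential sequence. In weight `-1`, `F⁰` contains no nonzero
real vector, which gives injectivity on the left; surjectivity on the right is built into the
definition of the sections. Exactness in the middle is the analytic point. A section of `ℋ` lying
pointwise in `F⁰ + H_ℤ` has, at each point, an integral part, and this must be shown locally
constant. Transversality of `F⁰` to the real vectors persists near a point with a uniform bound, so
integral parts cannot jump (`eventually_integral_part_eq_zero`, `exists_section_of_mem_F0Lattice`).
-/

noncomputable section

namespace NormalFunctions

/-! ### Holomorphic functions: continuity and arithmetic. -/

section Holomorphic

variable {S : Over (Spec (CommRingCat.of ℂ))}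

lemma evalAt_of_liesIn {U : S.left.Opens} (f : Γ(S.left, U)) {x : ComplexPoints S}
    (h : x.LiesIn U) : evalAt U f x =
      (Scheme.ΓSpecIso (CommRingCat.of ℂ)).hom (Scheme.Hom.appLE x.left U ⊤ h f) :=
  dif_pos h

lemma ComplexPoints.LiesIn.inf {U V : S.left.Opens} {x : ComplexPoints S}
    (hU : x.LiesIn U) (hV : x.LiesIn V) : x.LiesIn (U ⊓ V) :=
  fun _ hy => ⟨hU hy, hV hy⟩

lemma ComplexPoints.LiesIn.mono {U V : S.left.Opens} (h : U ≤ V) {x : ComplexPoints S}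
    (hU : x.LiesIn U) : x.LiesIn V :=
  fun _ hy => h (hU hy)

lemma isOpen_liesIn (U : S.left.Opens) : IsOpen {x : An S | ComplexPoints.LiesIn x U} :=
  TopologicalSpace.isOpen_generateFrom_of_mem ⟨U, 0, Set.univ, isOpen_univ, by simp⟩

lemma evalAt_map {U V : S.left.Opens} (h : U ≤ V) (f : Γ(S.left, V)) {x : ComplexPoints S}
    (hx : x.LiesIn U) : evalAt U (S.left.presheaf.map (homOfLE h).op f) x = evalAt V f x := by
  rw [evalAt_of_liesIn _ hx, evalAt_of_liesIn _ (hx.mono h)]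
  congr 1
  exact ConcreteCategory.congr_hom (Scheme.Hom.map_appLE x.left hx (homOfLE h).op) f

lemma continuousAt_evalAt {U : S.left.Opens} (f : Γ(S.left, U)) {x : An S}
    (hx : ComplexPoints.LiesIn x U) : ContinuousAt (fun y : An S => evalAt U f y) x := by
  rw [ContinuousAt, tendsto_nhds]
  intro W hW hxW
  have : IsOpen {y : An S | ComplexPoints.LiesIn y U ∧ evalAt U f y ∈ W} :=
    TopologicalSpace.isOpen_generateFrom_of_mem ⟨U, f, W, hW, rfl⟩
  exact Filter.mem_of_superset (this.mem_nhds ⟨hx, hxW⟩) fun y hy => hy.2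

lemma HolomorphicAt.continuousAt {h : An S → ℂ} {x : An S} (hh : HolomorphicAt h x) :
    ContinuousAt h x := by
  obtain ⟨U, n, f, g, hU, hg, he⟩ := hh
  refine ContinuousAt.congr ?_ (he.mono fun _ hy => hy.symm)
  exact ContinuousAt.comp (g := g) (f := fun y : An S => fun i => evalAt U (f i) y)
    hg.continuousAt (continuousAt_pi.mpr fun i => continuousAt_evalAt (f i) hU)

lemma HolomorphicAt.const (c : ℂ) (x : An S) : HolomorphicAt (fun _ => c) x :=
  ⟨⊤, 0, Fin.elim0, fun _ => c, le_top, analyticAt_const, Filter.Eventually.of_forall fun _ => rfl⟩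

/-- After restriction to the intersection of the two Zariski opens, the two lists of regular
functions are concatenated, and each power series is read in its own block of variables. All the
arithmetic operations below are instances. -/
lemma HolomorphicAt.comp₂ {h h' : An S → ℂ} {x : An S} (hh : HolomorphicAt h x)
    (hh' : HolomorphicAt h' x) {φ : ℂ × ℂ → ℂ} (hφ : AnalyticAt ℂ φ (h x, h' x)) :
    HolomorphicAt (fun y => φ (h y, h' y)) x := by
  obtain ⟨U, n, f, g, hU, hg, he⟩ := hh
  obtain ⟨U', n', f', g', hU', hg', he'⟩ := hh'
  let p : Fin (n + n') → Γ(S.left, U ⊓ U') := Fin.append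
    (fun i => S.left.presheaf.map (homOfLE (inf_le_left : U ⊓ U' ≤ U)).op (f i))
    (fun i => S.left.presheaf.map (homOfLE (inf_le_right : U ⊓ U' ≤ U')).op (f' i))
  have hp : ∀ y : An S, ComplexPoints.LiesIn y (U ⊓ U') →
      ((fun i => evalAt _ (p (Fin.castAdd n' i)) y) = fun i => evalAt U (f i) y) ∧
      ((fun i => evalAt _ (p (Fin.natAdd n i)) y) = fun i => evalAt U' (f' i) y) := by
    intro y hy
    constructor <;> funext i
    · simp only [p, Fin.append_left]; exact evalAt_map _ _ hy
    · simp only [p, Fin.append_right]; exact evalAt_map _ _ hy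
  have hx := hU.inf hU'
  refine ⟨U ⊓ U', n + n', p,
    fun z => φ (g fun i => z (Fin.castAdd n' i), g' fun i => z (Fin.natAdd n i)), hx, ?_, ?_⟩
  · have h1 : AnalyticAt ℂ (fun z : Fin (n + n') → ℂ => fun i => z (Fin.castAdd n' i))
        (fun i => evalAt _ (p i) x) :=
      (ContinuousLinearMap.pi fun i => ContinuousLinearMap.proj (R := ℂ)
        (φ := fun _ : Fin (n + n') => ℂ) (Fin.castAdd n' i)).analyticAt _
    have h2 : AnalyticAt ℂ (fun z : Fin (n + n') → ℂ => fun i => z (Fin.natAdd n i))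
        (fun i => evalAt _ (p i) x) :=
      (ContinuousLinearMap.pi fun i => ContinuousLinearMap.proj (R := ℂ)
        (φ := fun _ : Fin (n + n') => ℂ) (Fin.natAdd n i)).analyticAt _
    rw [he.self_of_nhds, he'.self_of_nhds] at hφ
    refine AnalyticAt.fun_comp ?_ (AnalyticAt.prod (AnalyticAt.fun_comp ?_ h1) (AnalyticAt.fun_comp ?_ h2))
    · rw [(hp x hx).1, (hp x hx).2]; exact hφ
    · rw [(hp x hx).1]; exact hg
    · rw [(hp x hx).2]; exact hg'
  · filter_upwards [he, he', (isOpen_liesIn (U ⊓ U')).mem_nhds hx] with y hy hy' hyU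
    rw [(hp y hyU).1, (hp y hyU).2, hy, hy']

lemma HolomorphicAt.add {h h' : An S → ℂ} {x : An S} (hh : HolomorphicAt h x)
    (hh' : HolomorphicAt h' x) : HolomorphicAt (fun y => h y + h' y) x :=
  hh.comp₂ hh' (φ := fun z => z.1 + z.2) (analyticAt_fst.add analyticAt_snd)

lemma HolomorphicAt.sub {h h' : An S → ℂ} {x : An S} (hh : HolomorphicAt h x)
    (hh' : HolomorphicAt h' x) : HolomorphicAt (fun y => h y - h' y) x :=
  hh.comp₂ hh' (φ := fun z => z.1 - z.2) (analyticAt_fst.sub analyticAt_snd)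

lemma HolomorphicAt.mul {h h' : An S → ℂ} {x : An S} (hh : HolomorphicAt h x)
    (hh' : HolomorphicAt h' x) : HolomorphicAt (fun y => h y * h' y) x :=
  hh.comp₂ hh' (φ := fun z => z.1 * z.2) (analyticAt_fst.mul analyticAt_snd)

lemma HolomorphicAt.div {h h' : An S → ℂ} {x : An S} (hh : HolomorphicAt h x)
    (hh' : HolomorphicAt h' x) (hx : h' x ≠ 0) : HolomorphicAt (fun y => h y / h' y) x :=
  hh.comp₂ hh' (φ := fun z => z.1 / z.2) (analyticAt_fst.div analyticAt_snd hx)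

lemma HolomorphicAt.sum {ι : Type*} (s : Finset ι) {h : ι → An S → ℂ} {x : An S}
    (hh : ∀ i ∈ s, HolomorphicAt (h i) x) : HolomorphicAt (fun y => ∑ i ∈ s, h i y) x := by
  classical
  induction s using Finset.induction_on with
  | empty => simpa using HolomorphicAt.const 0 x
  | insert i s hi ih =>
    simp only [Finset.sum_insert hi]
    exact (hh i (by simp)).add (ih fun j hj => hh j (by simp [hj]))

end Holomorphic

/-! ### Naturality of connecting maps. -/

/-- The connecting maps of two short exact sequences are compatible with morphisms of
sequences. -/
theorem connectingMap_naturality {S : Over (Spec (CommRingCat.of ℂ))}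
    {T T' : ShortComplex (AbSheaf S)} (hT : T.ShortExact) (hT' : T'.ShortExact) (φ : T ⟶ T')
    (s : T.X₃.obj.obj (op ⊤)) :
    CategoryTheory.Sheaf.H.map φ.τ₁ 1 (connectingMap hT s) =
      connectingMap hT' (φ.τ₃.hom.app (op ⊤) s) := by
  unfold connectingMap
  rw [← CategoryTheory.Sheaf.H.equiv₀_symm_naturality, CategoryTheory.Sheaf.H.map_apply,
    CategoryTheory.Sheaf.H.map_apply]
  set t := (CategoryTheory.Sheaf.H.equiv₀ T.X₃ (T := (⊤ : Opens (An S)))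
    Limits.isTerminalTop).symm s
  -- Connecting maps are Yoneda products with extension classes, so associativity reduces the claim
  -- to naturality of the extension class.
  change Abelian.Ext.comp (Abelian.Ext.comp t hT.extClass (zero_add 1)) (Abelian.Ext.mk₀ φ.τ₁)
      (add_zero 1) =
    Abelian.Ext.comp (Abelian.Ext.comp t (Abelian.Ext.mk₀ φ.τ₃) (add_zero 0)) hT'.extClass
      (zero_add 1)
  rw [Abelian.Ext.comp_assoc_of_third_deg_zero, hT.extClass_naturality hT' φ,
    Abelian.Ext.comp_assoc_of_second_deg_zero]

/-! ### Stalks, the constant sheaf, and coordinates of holomorphic sections. -/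

section Stalks

variable {S : Over (Spec (CommRingCat.of ℂ))}

lemma exists_germ_eq (L : AbSheaf S) {x : An S} (s : Stalk L x) :
    ∃ (V : Opens (An S)) (hx : x ∈ V) (e : L.obj.obj (op V)), germ L x hx e = s :=
  TopCat.Presheaf.exists_germ_eq L.obj s

lemma germ_res (L : AbSheaf S) {U V : Opens (An S)} (h : V ≤ U) {x : An S} (hx : x ∈ V)
    (e : L.obj.obj (op U)) :
    germ L x hx (L.obj.map (homOfLE h).op e) = germ L x (h hx) e :=
  TopCat.Presheaf.germ_res_apply L.obj (homOfLE h) x hx e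

lemma stalkMap_germ {L L' : AbSheaf S} (φ : L ⟶ L') {U : Opens (An S)} {x : An S} (hx : x ∈ U)
    (e : L.obj.obj (op U)) :
    stalkMap φ x (germ L x hx e) = germ L' x hx (φ.hom.app (op U) e) :=
  TopCat.Presheaf.stalkFunctor_map_germ_apply U x hx φ.hom e

/-- Sections with the same germ at a point agree near that point. -/
lemma exists_germ_eq_on (L : AbSheaf S) {U V : Opens (An S)} {x : An S} (hU : x ∈ U) (hV : x ∈ V)
    (e : L.obj.obj (op U)) (e' : L.obj.obj (op V)) (h : germ L x hU e = germ L x hV e') :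
    ∃ (W : Opens (An S)) (_ : x ∈ W) (hWU : W ≤ U) (hWV : W ≤ V),
      ∀ (y : An S) (hy : y ∈ W), germ L y (hWU hy) e = germ L y (hWV hy) e' := by
  obtain ⟨W, hW, i, j, hij⟩ := TopCat.Presheaf.germ_eq L.obj x hU hV e e' h
  refine ⟨W, hW, i.le, j.le, fun y hy => ?_⟩
  rw [← germ_res L i.le hy e, ← germ_res L j.le hy e']
  exact congrArg _ hij

lemma stalkMap_exact {T : ShortComplex (AbSheaf S)} (hT : T.Exact) (x : An S)
    (s : Stalk T.X₂ x) (hs : stalkMap T.g x s = 0) : ∃ t, stalkMap T.f x t = s :=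
  (ShortComplex.ab_exact_iff _).mp
    ((TopCat.Sheaf.exact_iff_stalkFunctor_map_exact T).mp hT x) s hs

lemma stalkMap_surjective {L L' : AbSheaf S} (φ : L ⟶ L') [hφ : Epi φ] (x : An S) :
    Function.Surjective (stalkMap φ x) :=
  (TopCat.Presheaf.locally_surjective_iff_surjective_on_stalks φ.hom).mp
    ((TopCat.Sheaf.isLocallySurjective_iff_epi φ).mpr hφ) x

variable (S) in
/-- The germ at `x` of the section `1` of the constant sheaf `ℤ`. -/
abbrev constOneGerm (x : An S) : Stalk (constZ S) x :=
  germ (constZ S) (U := ⊤) x trivial (constOne S)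

variable (S) in
/-- The canonical map from `ℤ` to the sections of the constant sheaf. -/
def constSection (V : Opens (An S)) : ULift.{0} ℤ →+ (constZ S).obj.obj (op V) :=
  ((toSheafify (Opens.grothendieckTopology (An S))
    ((Functor.const _).obj (AddCommGrpCat.of (ULift ℤ)))).app (op V)).hom

lemma constZ_map_constOne (V : Opens (An S)) :
    (constZ S).obj.map (homOfLE (le_top : V ≤ ⊤)).op (constOne S) = constSection S V ⟨1⟩ :=
  (ConcreteCategory.congr_hom ((toSheafify (Opens.grothendieckTopology (An S))
    ((Functor.const _).obj (AddCommGrpCat.of (ULift ℤ)))).naturality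
      (homOfLE (le_top : V ≤ ⊤)).op) (ULift.up 1)).symm

lemma germ_constSection {V : Opens (An S)} {x : An S} (hx : x ∈ V) (m : ℤ) :
    germ (constZ S) x hx (constSection S V ⟨m⟩) = m • constOneGerm S x := by
  have h : (⟨m⟩ : ULift.{0} ℤ) = m • ⟨1⟩ := ULift.ext _ _ (mul_one m).symm
  rw [h, map_zsmul, ← constZ_map_constOne]
  refine (map_zsmul (TopCat.Presheaf.germ (constZ S).obj V x hx).hom m _).trans ?_
  exact congrArg (m • ·) (germ_res (constZ S) le_top hx _)

/-- Every section of a sheafification comes locally from the presheaf, here from an integer. -/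
lemma exists_constOneGerm_smul_eq (x : An S) (s : Stalk (constZ S) x) :
    ∃ m : ℤ, s = m • constOneGerm S x := by
  obtain ⟨U, hxU, e, rfl⟩ := exists_germ_eq _ s
  obtain ⟨V, i, ⟨⟨m⟩, hm⟩, hxV⟩ := Presheaf.imageSieve_mem
    (Opens.grothendieckTopology (An S)) (toSheafify (Opens.grothendieckTopology (An S))
      ((Functor.const _).obj (AddCommGrpCat.of (ULift ℤ)))) e x hxU
  refine ⟨m, ?_⟩
  rw [← germ_constSection hxV]
  exact (germ_res (constZ S) i.le hxV e).symm.trans (congrArg (germ (constZ S) x hxV) hm.symm)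

/-- Sections of the presheaf that agree after sheafification agree locally. The constant presheaf
has value `ℤ` on every open set, so vanishing on one neighbourhood already forces `m = 0`. -/
lemma constOneGerm_smul_eq_zero (x : An S) (m : ℤ) (h : m • constOneGerm S x = 0) :
    m = 0 := by
  obtain ⟨V, hxV, hV₁, hV₂, hV⟩ := exists_germ_eq_on (constZ S) (x := x) (U := ⊤) (V := ⊤)
    (Opens.mem_top x) (Opens.mem_top x) (constSection S ⊤ ⟨m⟩) 0
    ((germ_constSection _ m).trans (h.trans (map_zero _).symm))
  have h0 : constSection S V ⟨m⟩ = 0 :=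
    TopCat.Presheaf.section_ext (constZ S) V _ _ fun y hy => by
      refine (germ_constSection hy m).trans ((germ_constSection (V := ⊤) trivial m).symm.trans
        ((hV y hy).trans ?_))
      exact (map_zero (TopCat.Presheaf.germ (constZ S).obj ⊤ y (Opens.mem_top y)).hom).trans (map_zero _).symm
  obtain ⟨W, i, hW, hxW⟩ := Presheaf.equalizerSieve_mem
    (Opens.grothendieckTopology (An S)) (toSheafify (Opens.grothendieckTopology (An S))
      ((Functor.const _).obj (AddCommGrpCat.of (ULift ℤ)))) (X := op V) (⟨m⟩ : ULift ℤ) 0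
      (h0.trans (map_zero _).symm) x hxV
  exact congrArg ULift.down (show (⟨m⟩ : ULift.{0} ℤ) = 0 from hW)

/-- The stalk is `ℤ`, so the fiber is `ℂ`. This is what prevents all of `F⁰H'` from projecting to
zero. -/
lemma fiber_constZ_top_ne_bot (x : An S) :
    (⊤ : Submodule ℂ (Fiber (constZ S) x)) ≠ ⊥ := by
  let a : ℤ ≃ₗ[ℤ] Stalk (constZ S) x := LinearEquiv.ofBijective
    (LinearMap.toSpanSingleton ℤ _ (constOneGerm S x))
    ⟨(injective_iff_map_eq_zero _).mpr fun m hm => constOneGerm_smul_eq_zero x m hm, fun s => by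
      obtain ⟨m, rfl⟩ := exists_constOneGerm_smul_eq x s
      exact ⟨m, rfl⟩⟩
  let b := (LinearEquiv.baseChange ℤ ℂ _ _ a).symm.trans (TensorProduct.AlgebraTensorModule.rid ℤ ℂ ℂ)
  have : Nontrivial (Fiber (constZ S) x) := b.toEquiv.nontrivial
  exact top_ne_bot

lemma fiberMap_tmul {L L' : AbSheaf S} (φ : L ⟶ L') (x : An S) (c : ℂ) (s : Stalk L x) :
    fiberMap φ x (c ⊗ₜ[ℤ] s) = c ⊗ₜ[ℤ] stalkMap φ x s := rfl

lemma fiberMap_toFiber {L L' : AbSheaf S} (φ : L ⟶ L') (x : An S) (s : Stalk L x) :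
    fiberMap φ x (toFiber L x s) = toFiber L' x (stalkMap φ x s) := rfl

lemma toFiber_apply (L : AbSheaf S) (x : An S) (s : Stalk L x) :
    toFiber L x s = (1 : ℂ) ⊗ₜ[ℤ] s := rfl

/-- Near a point at which the germs of `e` generate the stalk, a holomorphic section is a
combination of `e` with holomorphic coefficients. -/
lemma IsHolomorphicSection.exists_eq_combination {L : AbSheaf S} {U V : Opens (An S)}
    {v : ∀ y : U, Fiber L y} (hv : IsHolomorphicSection L U v) {x : An S} (hxU : x ∈ U)
    (hxV : x ∈ V) {r : ℕ} (e : Fin r → L.obj.obj (op V))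
    (he : Submodule.span ℤ (Set.range fun k => germ L x hxV (e k)) = ⊤) :
    ∃ (W : Opens (An S)) (_ : x ∈ W) (hWU : W ≤ U) (hWV : W ≤ V) (f : Fin r → An S → ℂ),
      (∀ k, ∀ y ∈ W, HolomorphicAt (f k) y) ∧
        ∀ (y : An S) (hy : y ∈ W),
          v ⟨y, hWU hy⟩ = ∑ k, f k y ⊗ₜ[ℤ] germ L y (hWV hy) (e k) := by
  obtain ⟨V₁, hx₁, hV₁, n, g, e', hg, hv'⟩ := hv ⟨x, hxU⟩
  -- The change of generators from `e'` to `e` is an integer matrix at `x`; equality of germs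
  -- spreads it, with the same constants, over a neighbourhood.
  have hN : ∀ j, ∃ N : Fin r → ℤ, ∑ k, N k • germ L x hxV (e k) = germ L x hx₁ (e' j) := fun j =>
    (Submodule.mem_span_range_iff_exists_fun ℤ).mp (he ▸ Submodule.mem_top)
  choose N hN using hN
  have hW : ∀ j, ∃ (W : Opens (An S)) (_ : x ∈ W) (hWV : W ≤ V) (hW₁ : W ≤ V₁),
      ∀ (y : An S) (hy : y ∈ W),
        ∑ k, N j k • germ L y (hWV hy) (e k) = germ L y (hW₁ hy) (e' j) := by
    intro j
    obtain ⟨W, hxW, h₁, h₂, h⟩ := exists_germ_eq_on L hxV hx₁ (∑ k, N j k • e k) (e' j)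
      (by simpa only [map_sum, map_zsmul] using hN j)
    refine ⟨W, hxW, h₁, h₂, fun y hy => ?_⟩
    simpa only [map_sum, map_zsmul] using h y hy
  choose W hxW hWV hW₁ hW using hW
  let Z : Opens (An S) := (V₁ ⊓ V) ⊓ Finset.univ.inf W
  have hZ : ∀ j, Z ≤ W j := fun j => inf_le_right.trans (Finset.inf_le (Finset.mem_univ j))
  refine ⟨Z, ⟨⟨hx₁, hxV⟩, ?_⟩, inf_le_left.trans (inf_le_left.trans hV₁),
    inf_le_left.trans inf_le_right, fun k y => ∑ j, (N j k : ℂ) * g j y, ?_, ?_⟩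
  · simpa using fun j => hxW j
  · intro k y hy
    exact HolomorphicAt.sum _ fun j _ => (HolomorphicAt.const _ _).mul (hg j y hy.1.1)
  · intro y hy
    refine (hv' ⟨y, hy.1.1⟩).trans ?_
    unfold combination
    simp only [TensorProduct.sum_tmul]
    rw [Finset.sum_comm]
    refine Finset.sum_congr rfl fun j _ => ?_
    rw [← hW j y (hZ j hy), TensorProduct.tmul_sum]
    refine Finset.sum_congr rfl fun k _ => ?_
    rw [TensorProduct.tmul_smul, TensorProduct.smul_tmul', zsmul_eq_mul]

lemma isHolomorphicSection_combination {L : AbSheaf S} {U V : Opens (An S)} (h : U ≤ V) {r : ℕ}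
    {f : Fin r → An S → ℂ} (e : Fin r → L.obj.obj (op V))
    (hf : ∀ k, ∀ y ∈ U, HolomorphicAt (f k) y) :
    IsHolomorphicSection L U fun y => ∑ k, f k y ⊗ₜ[ℤ] germ L y.1 (h y.2) (e k) := fun x =>
  ⟨U, x.2, le_rfl, r, f, fun k => L.obj.map (homOfLE h).op (e k), hf, fun y => by
    unfold combination
    exact Finset.sum_congr rfl fun k _ => by rw [germ_res]⟩

end Stalks

/-! ### Rigidity of integral parts near a point. -/

/-- The real linear map `(c, n) ↦ ∑ c_i a_i + n`. -/
def realExtension {k r : ℕ} (a : Fin k → Fin r → ℂ) :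
    ((Fin k → ℂ) × (Fin r → ℝ)) →ₗ[ℝ] (Fin r → ℂ) where
  toFun p := ∑ i, p.1 i • a i + fun j => (p.2 j : ℂ)
  map_add' p q := by
    ext j
    simp only [Prod.fst_add, Prod.snd_add, Pi.add_apply, Finset.sum_apply, Pi.smul_apply, add_smul,
      Finset.sum_add_distrib, Complex.ofReal_add]
    ring
  map_smul' t p := by
    ext j
    simp [Finset.mul_sum, mul_assoc]

/-- The two maps differ by `∑ c_i (b_i - a_i)`. This transfers the lower bound available for the
frame at `x` to nearby frames. -/
lemma norm_realExtension_le {k r : ℕ} (a b : Fin k → Fin r → ℂ)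
    (p : (Fin k → ℂ) × (Fin r → ℝ)) :
    ‖realExtension a p‖ ≤ ‖realExtension b p‖ + (∑ i, ‖b i - a i‖) * ‖p‖ := by
  have h : realExtension a p = realExtension b p - ∑ i, p.1 i • (b i - a i) := by
    simp only [realExtension, LinearMap.coe_mk, AddHom.coe_mk, smul_sub, Finset.sum_sub_distrib]
    abel
  rw [h, Finset.sum_mul]
  refine (norm_sub_le _ _).trans (add_le_add le_rfl ((norm_sum_le _ _).trans
    (Finset.sum_le_sum fun i _ => ?_)))
  rw [norm_smul, mul_comm]
  exact mul_le_mul_of_nonneg_left ((norm_le_pi_norm p.1 i).trans (norm_fst_le p)) (norm_nonneg _)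

/-- Let `a y` be a continuous family of vectors that spans at `x` a subspace transverse to the
real vectors, and `u` a continuous function whose value at `x` lies in the span of `a x`. Near `x`
the only integral vector that is congruent to `u y` modulo the span of `a y` is zero. -/
lemma eventually_integral_part_eq_zero {X : Type*} [TopologicalSpace X] {x : X} {k r : ℕ}
    {a : X → Fin k → Fin r → ℂ} (ha : ∀ i, ContinuousAt (fun y => a y i) x)
    {u : X → Fin r → ℂ} (hu : ContinuousAt u x)
    (hinj : ∀ (c : Fin k → ℂ) (n : Fin r → ℝ),
      ∑ i, c i • a x i + (fun j => (n j : ℂ)) = 0 → c = 0 ∧ n = 0)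
    {c₀ : Fin k → ℂ} (hc₀ : u x = ∑ i, c₀ i • a x i) :
    ∀ᶠ y in 𝓝 x, ∀ (c : Fin k → ℂ) (n : Fin r → ℤ),
      u y = ∑ i, c i • a y i + (fun j => (n j : ℂ)) → n = 0 := by
  -- By `hinj` the map at `x` is injective; as its source is finite-dimensional it is bounded below,
  -- with constant `1 / K`.
  obtain ⟨K, hK, hT⟩ := (realExtension (a x)).exists_antilipschitzWith
    (LinearMap.ker_eq_bot'.mpr fun p hp =>
      Prod.ext (hinj p.1 p.2 hp).1 (hinj p.1 p.2 hp).2)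
  have hs : ContinuousAt (fun y => (K : ℝ) * ∑ i, ‖a y i - a x i‖) x := by fun_prop
  have hd : ContinuousAt (fun y => (K : ℝ) * ‖u y - ∑ i, c₀ i • a y i‖) x := by fun_prop
  have hs' := hs.eventually_lt (g := fun _ => (1 / 2 : ℝ)) continuousAt_const (by simp)
  have hd' := hd.eventually_lt (g := fun _ => (1 / 2 : ℝ)) continuousAt_const (by simp [hc₀])
  filter_upwards [hs', hd'] with y hy hy' c n hn
  -- Subtracting `c₀` makes the image of `p` under the map at `y` equal to `u y - ∑ c₀ i • a y i`,
  -- which is small because it vanishes at `x`. No bound on `c` is needed.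
  let p : (Fin k → ℂ) × (Fin r → ℝ) := (c - c₀, fun j => n j)
  have h1 : ‖p‖ ≤ K * ‖realExtension (a x) p‖ := by simpa using hT.le_mul_dist p 0
  have h2 : realExtension (a y) p = u y - ∑ i, c₀ i • a y i := by
    simp only [hn, p, realExtension, LinearMap.coe_mk, AddHom.coe_mk, Pi.sub_apply, sub_smul,
      Finset.sum_sub_distrib, Complex.ofReal_intCast]
    abel
  have h3 := norm_realExtension_le (a x) (a y) p
  rw [h2] at h3
  have h4 := h1.trans (mul_le_mul_of_nonneg_left h3 K.2)
  rw [mul_add, ← mul_assoc] at h4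
  -- The estimate reads `‖p‖ < 1/2 + ‖p‖/2`; an integer vector of sup norm less than `1` is zero.
  have h5 : ‖p‖ < 1 := by
    have := mul_le_mul_of_nonneg_right hy.le (norm_nonneg p)
    linarith
  ext j
  have h6 : ‖(n j : ℝ)‖ < 1 := ((norm_le_pi_norm p.2 j).trans (norm_snd_le p)).trans_lt h5
  rw [Real.norm_eq_abs, ← Int.cast_abs, ← Int.cast_one, Int.cast_lt] at h6
  exact Int.abs_lt_one_iff.mp h6

/-! ### Local splitting of sections with values in `F⁰ + H_ℤ`. -/

section ExponentialSequence

variable {S : Over (Spec (CommRingCat.of ℂ))}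

/-- A `ℤ`-basis of the stalk becomes a `ℂ`-basis of the fiber. This allows coordinates to be
compared in `Fin r → ℂ`, where the rigidity lemma applies. -/
lemma sum_tmul_injective {L : AbSheaf S} {x : An S} {r : ℕ} {e : Fin r → Stalk L x}
    (hli : LinearIndependent ℤ e) (hsp : Submodule.span ℤ (Set.range e) = ⊤) :
    Function.Injective fun c : Fin r → ℂ => (∑ k, c k ⊗ₜ[ℤ] e k : Fiber L x) := by
  let b := (Module.Basis.mk hli hsp.ge).baseChange ℂ
  have h : ∀ c : Fin r → ℂ, (∑ k, c k ⊗ₜ[ℤ] e k : Fiber L x) = b.equivFun.symm c := fun c => by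
    simp [b, Module.Basis.equivFun_symm_apply, TensorProduct.smul_tmul']
  simp only [h]
  exact b.equivFun.symm.injective

lemma toFiber_sum_zsmul {L : AbSheaf S} {x : An S} {r : ℕ} (n : Fin r → ℤ)
    (e : Fin r → Stalk L x) :
    toFiber L x (∑ j, n j • e j) = ∑ j, (n j : ℂ) ⊗ₜ[ℤ] e j := by
  rw [toFiber_apply, TensorProduct.tmul_sum]
  exact Finset.sum_congr rfl fun k _ => by
    rw [TensorProduct.tmul_smul, TensorProduct.smul_tmul', zsmul_eq_mul, mul_one]

lemma IsLocalSystem.toFiber_injective {L : AbSheaf S} (hL : IsLocalSystem L) (x : An S) :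
    Function.Injective (toFiber L x) := by
  obtain ⟨V, hx, r, e, he⟩ := hL x
  refine (injective_iff_map_eq_zero _).mpr fun s hs => ?_
  obtain ⟨N, rfl⟩ := (Submodule.mem_span_range_iff_exists_fun ℤ).mp
    ((he x hx).2.symm ▸ Submodule.mem_top : s ∈ _)
  have h0 : (fun k => (N k : ℂ)) = 0 := sum_tmul_injective (he x hx).1 (he x hx).2 <| by
    simp only [Pi.zero_apply, TensorProduct.zero_tmul, Finset.sum_const_zero]
    rw [← hs, toFiber_sum_zsmul]
  exact Finset.sum_eq_zero fun k _ => by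
    rw [Int.cast_eq_zero.mp (congrFun h0 k), zero_smul]

lemma fiberConj_tmul (L : AbSheaf S) (x : An S) (c : ℂ) (s : Stalk L x) :
    fiberConj L x (c ⊗ₜ[ℤ] s) = (starRingEnd ℂ c) ⊗ₜ[ℤ] s := rfl

/-- A Hodge structure of weight `-1` has no real vectors in `F ^ 0`. -/
lemma VHS.eq_zero_of_mem_F0 (H : VHS S (-1)) {x : An S} {z : Fiber H.L x}
    (hz : z ∈ H.hodge.F 0 x) (hconj : fiberConj H.L x z = z) : z = 0 :=
  -- In weight `-1` the condition `p + q = w + 1` allows `p = q = 0`, so `F⁰` and its conjugate meet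
  -- only in zero.
  AddSubgroup.disjoint_def.mp ((H.pure x).opposed 0 0 (by norm_num)).disjoint hz ⟨z, hz, hconj⟩

/-- A holomorphic section with values in `F ^ 0 + H_ℤ` is locally the sum of a section of `F ^ 0`
and a section of `H_ℤ`. -/
lemma VHS.exists_section_of_mem_F0Lattice (H : VHS S (-1)) {U : Opens (An S)}
    {v : ∀ y : U, Fiber H.L y} (hv : IsHolomorphicSection H.L U v)
    (hv' : ∀ y : U, v y ∈ H.F0Lattice y) {x : An S} (hxU : x ∈ U) :
    ∃ (W : Opens (An S)) (_ : x ∈ W) (hWU : W ≤ U) (t : H.L.obj.obj (op W)),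
      ∀ (y : An S) (hy : y ∈ W),
        v ⟨y, hWU hy⟩ - toFiber H.L y (germ H.L y hy t) ∈ H.F0 y := by
  obtain ⟨V, hxV, r, e, he⟩ := H.isLocalSystem x
  obtain ⟨V', hxV', k, a, ha, hF⟩ := H.hodge.subbundle 0 x
  obtain ⟨W₀, hx₀, hW₀U, hW₀V, f, hf, hvf⟩ := hv.exists_eq_combination hxU hxV e (he x hxV).2
  have h := fun i => (ha i).exists_eq_combination hxV' hxV e (he x hxV).2
  choose W₁ hx₁ hW₁V' hW₁V A hA haA using h
  -- decomposition in coordinates at a point of `U`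
  have hdec : ∀ (y : An S) (hy : y ∈ U) (hyV : y ∈ V) (hyV' : y ∈ V'),
      ∃ (c : Fin k → ℂ) (n : Fin r → ℤ), v ⟨y, hy⟩ = ∑ i, c i • a i ⟨y, hyV'⟩ +
        ∑ j, (n j : ℂ) ⊗ₜ[ℤ] germ H.L y hyV (e j) := by
    intro y hy hyV hyV'
    obtain ⟨φ, hφ, _, ⟨s, rfl⟩, hs⟩ := AddSubgroup.mem_sup.mp (hv' ⟨y, hy⟩)
    obtain ⟨c, rfl⟩ := (Submodule.mem_span_range_iff_exists_fun ℂ).mp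
      (show φ ∈ Submodule.span ℂ (Set.range fun i => a i ⟨y, hyV'⟩) by
        rw [(hF ⟨y, hyV'⟩).2]; exact hφ)
    obtain ⟨n, rfl⟩ := (Submodule.mem_span_range_iff_exists_fun ℤ).mp
      ((he y hyV).2.symm ▸ Submodule.mem_top : s ∈ _)
    refine ⟨c, n, hs.symm.trans ?_⟩
    rw [toFiber_sum_zsmul]
  -- The integral part `n₀` at `x` is the candidate everywhere nearby: `t` will be the flat section
  -- `∑ n₀ j • e j`.
  obtain ⟨c₀, n₀, h₀⟩ := hdec x hxU hxV hxV'
  let Z : Opens (An S) := (W₀ ⊓ V') ⊓ Finset.univ.inf W₁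
  have hxZ : x ∈ Z := ⟨⟨hx₀, hxV'⟩, by simpa using fun j => hx₁ j⟩
  have hZ : ∀ j, Z ≤ W₁ j := fun j => inf_le_right.trans (Finset.inf_le (Finset.mem_univ j))
  have hcoord : ∀ (y : An S) (hy : y ∈ Z) (c : Fin k → ℂ) (n : Fin r → ℂ),
      ∑ i, c i • a i ⟨y, hy.1.2⟩ + ∑ j, n j ⊗ₜ[ℤ] germ H.L y (hW₀V hy.1.1) (e j) =
        ∑ j, (∑ i, c i • (fun j => A i j y) + n) j ⊗ₜ[ℤ] germ H.L y (hW₀V hy.1.1) (e j) := by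
    intro y hy c n
    simp only [Pi.add_apply, TensorProduct.add_tmul, Finset.sum_add_distrib, Finset.sum_apply,
      Pi.smul_apply, TensorProduct.sum_tmul]
    congr 1
    rw [Finset.sum_comm]
    refine Finset.sum_congr rfl fun i _ => ?_
    rw [haA i y (hZ i hy), Finset.smul_sum]
    exact Finset.sum_congr rfl fun j _ => TensorProduct.smul_tmul' _ _ _
  -- With `n₀` subtracted from the coordinates of `v`, the value at `x` lies in the span of the
  -- frame of `F⁰`, as the rigidity lemma requires.
  have hev := eventually_integral_part_eq_zero (x := x) (a := fun y i j => A i j y)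
    (u := fun y j => f j y - n₀ j)
    (fun i => continuousAt_pi.mpr fun j => (hA i j x (hx₁ i)).continuousAt)
    (continuousAt_pi.mpr fun j => (hf j x hx₀).continuousAt.sub continuousAt_const)
    (c₀ := c₀) ?_ ?_
  · obtain ⟨Q, hQ, hQo, hxQ⟩ := eventually_nhds_iff.mp hev
    refine ⟨Z ⊓ ⟨Q, hQo⟩, ⟨hxZ, hxQ⟩, inf_le_left.trans (inf_le_left.trans
      (inf_le_left.trans hW₀U)), H.L.obj.map (homOfLE (inf_le_left.trans (inf_le_left.trans
      (inf_le_left.trans hW₀V)))).op (∑ j, n₀ j • e j), fun y hy => ?_⟩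
    obtain ⟨c, n, hcn⟩ := hdec y (hW₀U hy.1.1.1) (hW₀V hy.1.1.1) hy.1.1.2
    -- Any decomposition of `v` at `y` has integral part `n₀`, so what remains of `v` lies in `F⁰`.
    have hn : n - n₀ = 0 := by
      refine hQ y hy.2 c (n - n₀) ?_
      have h1 := (hvf y hy.1.1.1).symm.trans (hcn.trans (hcoord y hy.1 c fun j => (n j : ℂ)))
      have h2 := sum_tmul_injective (he y (hW₀V hy.1.1.1)).1 (he y (hW₀V hy.1.1.1)).2 h1
      ext j
      have h3 := congrFun h2 j
      simp only [Pi.add_apply, Pi.sub_apply, Int.cast_sub] at h3 ⊢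
      rw [h3]
      ring
    obtain rfl := sub_eq_zero.mp hn
    have hg : germ H.L y hy (H.L.obj.map (homOfLE (inf_le_left.trans (inf_le_left.trans
        (inf_le_left.trans hW₀V)))).op (∑ j, n j • e j)) =
        ∑ j, n j • germ H.L y (hW₀V hy.1.1.1) (e j) := by
      rw [germ_res]
      simp only [map_sum, map_zsmul]
    rw [hg, toFiber_sum_zsmul, hcn, add_sub_cancel_right]
    change _ ∈ H.hodge.F 0 y
    rw [← (hF ⟨y, hy.1.1.2⟩).2]
    exact Submodule.sum_mem _ fun i _ => Submodule.smul_mem _ _ (Submodule.subset_span ⟨i, rfl⟩)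
  -- Transversality at `x`: the relation puts the real vector `n` in `F⁰`, so it vanishes, and then
  -- independence of the frame gives `c = 0`.
  · intro c n hcn
    have h1 := hcoord x hxZ c fun j => (n j : ℂ)
    rw [hcn] at h1
    simp only [Pi.zero_apply, TensorProduct.zero_tmul, Finset.sum_const_zero] at h1
    have h2 : (∑ j, (n j : ℂ) ⊗ₜ[ℤ] germ H.L x hxV (e j) : Fiber H.L x) = 0 := by
      refine H.eq_zero_of_mem_F0 ?_ ?_
      · rw [← neg_eq_of_add_eq_zero_right h1, ← (hF ⟨x, hxV'⟩).2]
        exact Submodule.neg_mem _ (Submodule.sum_mem _ fun i _ =>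
          Submodule.smul_mem _ _ (Submodule.subset_span ⟨i, rfl⟩))
      · simp [fiberConj_tmul]
    have h3 : (fun j => (n j : ℂ)) = 0 :=
      sum_tmul_injective (he x hxV).1 (he x hxV).2 (h2.trans (by simp))
    rw [h2, add_zero] at h1
    exact ⟨funext (Fintype.linearIndependent_iff.mp (hF ⟨x, hxV'⟩).1 c h1),
      funext fun j => Complex.ofReal_eq_zero.mp (congrFun h3 j)⟩
  · have h1 := (hvf x hx₀).symm.trans (h₀.trans (hcoord x hxZ c₀ fun j => (n₀ j : ℂ)))
    have h2 := sum_tmul_injective (he x hxV).1 (he x hxV).2 h1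
    ext j
    have h3 := congrFun h2 j
    simp only [Pi.add_apply] at h3
    simp only [h3, add_sub_cancel_right]

end ExponentialSequence

/-! ### Exactness of the exponential sequence. -/

section Exactness

variable {S : Over (Spec (CommRingCat.of ℂ))}

lemma fiberConj_toFiber (L : AbSheaf S) (x : An S) (s : Stalk L x) :
    fiberConj L x (toFiber L x s) = toFiber L x s := by
  rw [toFiber_apply, fiberConj_tmul, map_one]

/-- Integral vectors are fixed by conjugation, so one that lies in `F⁰` is zero. -/
lemma VHS.mono_toQuotientSheaf (H : VHS S (-1)) : Mono (toQuotientSheaf H.L H.F0) := by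
  refine CategoryTheory.Sheaf.mono_of_injective _ fun U =>
    (injective_iff_map_eq_zero ((toQuotientSheaf H.L H.F0).hom.app U).hom).mpr fun e he => ?_
  refine TopCat.Presheaf.section_ext H.L U.unop _ _ fun y hy => ?_
  have h1 : (QuotientAddGroup.mk (toFiber H.L y (germ H.L y hy e)) : Fiber H.L y ⧸ H.F0 y) = 0 :=
    congrFun (congrArg Subtype.val he) ⟨y, hy⟩
  have h2 := H.eq_zero_of_mem_F0 ((QuotientAddGroup.eq_zero_iff _).mp h1)
    (fiberConj_toFiber _ _ _)
  exact (H.isLocalSystem.toFiber_injective y (h2.trans (map_zero _).symm)).trans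
    (map_zero (TopCat.Presheaf.germ H.L.obj _ y hy).hom).symm

/-- A section of the coarser quotient has, by definition, local holomorphic lifts to `L ⊗ 𝒪`; these
can be reduced modulo `N` as well. -/
lemma epi_quotientSheafMap (L : AbSheaf S) {N N' : ∀ x : An S, AddSubgroup (Fiber L x)}
    (h : ∀ x, N x ≤ N' x) : Epi (quotientSheafMap L h) := by
  refine (TopCat.Sheaf.isLocallySurjective_iff_epi (quotientSheafMap L h)).mp
    ((TopCat.Presheaf.isLocallySurjective_iff _).mpr fun U q x hx => ?_)
  obtain ⟨V, hxV, hVU, v, hv, e⟩ := q.2 ⟨x, hx⟩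
  refine ⟨V, hVU, ⟨⟨fun y => QuotientAddGroup.mk (v y), fun y =>
    ⟨V, y.2, le_rfl, v, hv, fun _ => rfl⟩⟩, ?_⟩, hxV⟩
  exact Subtype.ext (funext fun y => (e y).symm)

lemma VHS.exact_exponentialSequence (H : VHS S (-1)) : H.exponentialSequence.Exact := by
  refine (TopCat.Sheaf.exact_iff_stalkFunctor_map_exact H.exponentialSequence).mpr fun x =>
    (ShortComplex.ab_exact_iff _).mpr fun z hz => ?_
  obtain ⟨U, hxU, q, rfl⟩ := exists_germ_eq H.modF0Sheaf z
  obtain ⟨V, hxV, hVU, v, hv, hq⟩ := q.2 ⟨x, hxU⟩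
  have h0 : germ H.jacobianSheaf x hxU (H.exponentialSequence.g.hom.app (op U) q) =
      germ H.jacobianSheaf x hxU 0 :=
    (stalkMap_germ H.exponentialSequence.g hxU q).symm.trans (hz.trans
      (map_zero (TopCat.Presheaf.germ H.jacobianSheaf.obj U x hxU).hom).symm)
  obtain ⟨W, hxW, i, j, hij⟩ := TopCat.Presheaf.germ_eq H.jacobianSheaf.obj x hxU hxU _ _ h0
  -- Vanishing of the germ in `𝒥(ℋ)` gives vanishing on `W`, which places the holomorphic lift `v`
  -- in `F⁰ + H_ℤ` at every point there.
  have hmem : ∀ y : (V ⊓ W : Opens (An S)), v ⟨y, y.2.1⟩ ∈ H.F0Lattice y := by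
    intro y
    have h1 : QuotientAddGroup.map (H.F0 y) (H.F0Lattice y) (AddMonoidHom.id _) le_sup_left
        (q.1 ⟨y, hVU y.2.1⟩) = 0 := congrFun (congrArg Subtype.val hij) ⟨y, y.2.2⟩
    rw [hq ⟨y, y.2.1⟩] at h1
    exact (QuotientAddGroup.eq_zero_iff _).mp h1
  obtain ⟨Z, hxZ, hZ, t, ht⟩ := H.exists_section_of_mem_F0Lattice
    (hv.restrict inf_le_left) hmem (x := x) ⟨hxV, hxW⟩
  refine ⟨germ H.L x hxZ t, ?_⟩
  refine (stalkMap_germ H.exponentialSequence.f hxZ t).trans ?_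
  have hZU : Z ≤ U := hZ.trans (inf_le_left.trans hVU)
  refine Eq.trans ?_ (germ_res H.modF0Sheaf hZU hxZ q)
  refine congrArg _ (Subtype.ext (funext fun y => ?_))
  refine Eq.trans ?_ (hq ⟨y, (hZ y.2).1⟩).symm
  exact (QuotientAddGroup.eq_iff_sub_mem.mpr (ht y y.2)).symm

/-- The exponential sequence of the Jacobian fibration is exact. -/
theorem VHS.shortExact_exponentialSequence (H : VHS S (-1)) :
    H.exponentialSequence.ShortExact :=
  ShortComplex.ShortExact.mk' H.exact_exponentialSequence H.mono_toQuotientSheaf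
    (epi_quotientSheafMap H.L (N := H.F0) (N' := H.F0Lattice) fun _ => le_sup_left)

end Exactness

/-! ### From an extension to a morphism of short exact sequences. -/

section MixedExtension

variable {S : Over (Spec (CommRingCat.of ℂ))} {H : VHS S (-1)} (E : H.MixedExtension)

/-- `α` represents the class of the integral element `s` in `ℂ ⊗ H'_x / F ^ 0 = ℂ ⊗ H_x / F ^ 0`. -/
def VHS.MixedExtension.Represents (x : An S) (s : Stalk E.L x) (α : Fiber H.L x) : Prop :=
  toFiber E.L x s - fiberMap E.incl x α ∈ E.hodge.F 0 x

variable {E}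

lemma VHS.MixedExtension.Represents.add {x : An S} {s s' : Stalk E.L x} {α α' : Fiber H.L x}
    (h : E.Represents x s α) (h' : E.Represents x s' α') :
    E.Represents x (s + s') (α + α') := by
  unfold VHS.MixedExtension.Represents at *
  rw [map_add, map_add, add_sub_add_comm]
  exact add_mem h h'

/-- The difference of the two conditions puts the image of `α - α'` in `F⁰H'`, and `F⁰H'` induces
`F⁰` on `H`. -/
lemma VHS.MixedExtension.Represents.sub_mem {x : An S} {s : Stalk E.L x} {α α' : Fiber H.L x}
    (h : E.Represents x s α) (h' : E.Represents x s α') : α - α' ∈ H.F0 x := by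
  change α - α' ∈ H.hodge.F 0 x
  rw [← E.filtration_sub, Submodule.mem_comap, map_sub, ← sub_sub_sub_cancel_left]
  exact Submodule.sub_mem _ h' h

variable (E)

lemma VHS.MixedExtension.represents_incl (x : An S) (s : Stalk H.L x) :
    E.Represents x (stalkMap E.incl x s) (toFiber H.L x s) := by
  unfold VHS.MixedExtension.Represents
  rw [fiberMap_toFiber, sub_self]
  exact zero_mem _

lemma VHS.MixedExtension.stalkMap_proj_incl (x : An S) (s : Stalk H.L x) :
    stalkMap E.proj x (stalkMap E.incl x s) = 0 := by
  obtain ⟨U, hx, e, rfl⟩ := exists_germ_eq _ s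
  rw [stalkMap_germ, stalkMap_germ]
  have h := congrArg (fun φ : H.L ⟶ constZ S => (φ.hom.app (op U)).hom e) E.zero
  exact (congrArg (germ (constZ S) x hx) h).trans
    (map_zero (TopCat.Presheaf.germ (constZ S).obj U x hx).hom)

/-- The germs of `σ` and of the images of `e` generate the stalk of `H'` when those of `e` generate
the stalk of `H` and `σ` maps to `1`. -/
lemma VHS.MixedExtension.span_cons_eq_top {x : An S} {r : ℕ} (e : Fin r → Stalk H.L x)
    (he : Submodule.span ℤ (Set.range e) = ⊤) (σ : Stalk E.L x)
    (hσ : stalkMap E.proj x σ = constOneGerm S x) :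
    Submodule.span ℤ (Set.range (Fin.cons σ fun k => stalkMap E.incl x (e k) :
      Fin (r + 1) → Stalk E.L x)) = ⊤ := by
  refine eq_top_iff.mpr fun s _ => ?_
  obtain ⟨m, hm⟩ := exists_constOneGerm_smul_eq x (stalkMap E.proj x s)
  obtain ⟨t, ht⟩ := stalkMap_exact E.shortExact.exact x (s - m • σ)
    ((map_sub _ _ _).trans (by rw [map_zsmul]; exact sub_eq_zero.mpr (hσ ▸ hm)))
  obtain ⟨n, rfl⟩ := (Submodule.mem_span_range_iff_exists_fun ℤ).mp
    (he.symm ▸ Submodule.mem_top : t ∈ Submodule.span ℤ (Set.range e))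
  refine (Submodule.mem_span_range_iff_exists_fun ℤ).mpr ⟨Fin.cons m n, ?_⟩
  rw [Fin.sum_univ_succ]
  simp only [Fin.cons_zero, Fin.cons_succ]
  rw [eq_add_of_sub_eq' ht.symm, map_sum]
  simp only [map_zsmul]

/-- Sections of `H'` are locally represented by holomorphic sections of `ℂ ⊗ H`. -/
lemma VHS.MixedExtension.exists_represents {U : Opens (An S)} (s : E.L.obj.obj (op U)) {x : An S}
    (hxU : x ∈ U) :
    ∃ (W : Opens (An S)) (_ : x ∈ W) (hWU : W ≤ U) (α : ∀ y : W, Fiber H.L y),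
      IsHolomorphicSection H.L W α ∧
        ∀ y : W, E.Represents y (germ E.L y.1 (hWU y.2) s) (α y) := by
  obtain ⟨V₀, hxV₀, r, e₀, he₀⟩ := H.isLocalSystem x
  have := E.shortExact.epi_g
  obtain ⟨σ₀, hσ₀⟩ := stalkMap_surjective E.proj (hφ := this) x (constOneGerm S x)
  obtain ⟨V₁, hxV₁, σ₁, rfl⟩ := exists_germ_eq _ σ₀
  obtain ⟨V', hxV', k, a, ha, hF⟩ := E.hodge.subbundle 0 x
  let V : Opens (An S) := V₀ ⊓ V₁
  have hxV : x ∈ V := ⟨hxV₀, hxV₁⟩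
  let e : Fin r → H.L.obj.obj (op V) := fun j => H.L.obj.map (homOfLE inf_le_left).op (e₀ j)
  let σ : E.L.obj.obj (op V) := E.L.obj.map (homOfLE inf_le_right).op σ₁
  let b : Fin (r + 1) → E.L.obj.obj (op V) := Fin.cons σ fun j => E.incl.hom.app (op V) (e j)
  have hb₀ : ∀ (y : An S) (hy : y ∈ V), germ E.L y hy (b 0) = germ E.L y hy σ := fun y hy => rfl
  have hb₁ : ∀ (y : An S) (hy : y ∈ V) (j : Fin r),
      germ E.L y hy (b j.succ) = stalkMap E.incl y (germ H.L y hy (e j)) :=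
    fun y hy j => (stalkMap_germ E.incl hy (e j)).symm
  have hσ : stalkMap E.proj x (germ E.L x hxV σ) = constOneGerm S x := by
    rw [← hσ₀]; exact congrArg _ (germ_res E.L inf_le_right hxV σ₁)
  have hb : Submodule.span ℤ (Set.range fun j => germ E.L x hxV (b j)) = ⊤ := by
    rw [← E.span_cons_eq_top (fun j => germ H.L x hxV (e j)) ?_ (germ E.L x hxV σ) hσ]
    · congr 2
      funext j
      refine Fin.cases ?_ (fun j => ?_) j
      · rfl
      · exact hb₁ x hxV j
    · rw [← (he₀ x hxV₀).2]
      congr 2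
      exact funext fun j => germ_res H.L inf_le_left hxV (e₀ j)
  have hsum : ∀ (y : An S) (hy : y ∈ V) (f : Fin (r + 1) → ℂ),
      (∑ j, f j ⊗ₜ[ℤ] germ E.L y hy (b j) : Fiber E.L y) = f 0 • toFiber E.L y (germ E.L y hy σ) +
        fiberMap E.incl y (∑ j : Fin r, f j.succ ⊗ₜ[ℤ] germ H.L y hy (e j)) := by
    intro y hy f
    rw [Fin.sum_univ_succ, map_sum, hb₀, toFiber_apply, TensorProduct.smul_tmul', smul_eq_mul,
      mul_one]
    congr 1
    exact Finset.sum_congr rfl fun j _ => by rw [fiberMap_tmul, hb₁]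
  obtain ⟨W₀, hx₀, hW₀U, hW₀V, f, hf, hsf⟩ :=
    (isHolomorphicSection_toFiber E.L U s).exists_eq_combination hxU hxV b hb
  have h := fun i => (ha i).exists_eq_combination hxV' hxV b hb
  choose W₁ hx₁ hW₁V' hW₁V g hg hag using h
  -- some vector of the frame of `F ^ 0` has a nonzero projection to `ℂ`
  obtain ⟨i, hi⟩ : ∃ i, g i 0 x ≠ 0 := by
    by_contra! h0
    have h1 := E.filtration_quot 0 x
    rw [if_pos le_rfl, ← (hF ⟨x, hxV'⟩).2, Submodule.map_span] at h1
    refine fiber_constZ_top_ne_bot x (h1.symm.trans (Submodule.span_eq_bot.mpr ?_))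
    rintro _ ⟨_, ⟨i, rfl⟩, rfl⟩
    change fiberMap E.proj x (a i ⟨x, hxV'⟩) = 0
    rw [hag i x (hx₁ i), hsum, h0 i, zero_smul, zero_add, map_sum, map_sum]
    refine Finset.sum_eq_zero fun j _ => ?_
    rw [fiberMap_tmul, fiberMap_tmul, E.stalkMap_proj_incl, TensorProduct.tmul_zero]
  obtain ⟨Q, hQ, hQo, hxQ⟩ := eventually_nhds_iff.mp
    ((hg i 0 x (hx₁ i)).continuousAt.eventually_ne hi)
  let W : Opens (An S) := (W₀ ⊓ W₁ i) ⊓ ⟨Q, hQo⟩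
  have hWV : W ≤ V := inf_le_left.trans (inf_le_left.trans hW₀V)
  -- Subtracting `(f 0 / g i 0) • a i`, a vector of `F⁰`, from `s` cancels the coefficient of `σ`;
  -- what is left comes from `H` and is the required `α`. Its coefficients are holomorphic because
  -- `g i 0` has no zero on `W`.
  refine ⟨W, ⟨⟨hx₀, hx₁ i⟩, hxQ⟩, inf_le_left.trans (inf_le_left.trans hW₀U), _,
    isHolomorphicSection_combination hWV
      (f := fun j y => f j.succ y - f 0 y / g i 0 y * g i j.succ y) e fun j y hy =>
      (hf _ y hy.1.1).sub (((hf 0 y hy.1.1).div (hg i 0 y hy.1.2) (hQ y hy.2)).mul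
        (hg i _ y hy.1.2)), fun y => ?_⟩
  have h1 := (hsf y y.2.1.1).trans (hsum y (hWV y.2) fun j => f j y)
  have h2 := (hag i y y.2.1.2).trans (hsum y (hWV y.2) fun j => g i j y)
  have h3 : a i ⟨y, hW₁V' i y.2.1.2⟩ ∈ E.hodge.F 0 y := by
    rw [← (hF ⟨y, hW₁V' i y.2.1.2⟩).2]
    exact Submodule.subset_span ⟨i, rfl⟩
  have h4 : toFiber E.L y (germ E.L y.1 (hW₀U y.2.1.1) s) - fiberMap E.incl y
      (∑ j : Fin r, (f j.succ y - f 0 y / g i 0 y * g i j.succ y) ⊗ₜ[ℤ]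
        germ H.L y.1 (hWV y.2) (e j)) = (f 0 y / g i 0 y) • a i ⟨y, hW₁V' i y.2.1.2⟩ := by
    have h5 : (∑ j : Fin r, (f j.succ y - f 0 y / g i 0 y * g i j.succ y) ⊗ₜ[ℤ]
        germ H.L y.1 (hWV y.2) (e j) : Fiber H.L y) =
        ∑ j : Fin r, f j.succ y ⊗ₜ[ℤ] germ H.L y.1 (hWV y.2) (e j) - (f 0 y / g i 0 y) •
          ∑ j : Fin r, g i j.succ y ⊗ₜ[ℤ] germ H.L y.1 (hWV y.2) (e j) := by
      rw [Finset.smul_sum, ← Finset.sum_sub_distrib]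
      exact Finset.sum_congr rfl fun j _ => by
        rw [TensorProduct.sub_tmul, TensorProduct.smul_tmul', smul_eq_mul]
    rw [h5, h2, h1, map_sub, map_smul, smul_add, smul_smul, div_mul_cancel₀ _ (hQ y y.2.2)]
    abel
  unfold VHS.MixedExtension.Represents
  rw [h4]
  exact Submodule.smul_mem _ _ h3

lemma VHS.MixedExtension.exists_represents_stalk (x : An S) (s : Stalk E.L x) :
    ∃ α, E.Represents x s α := by
  obtain ⟨U, hx, e, rfl⟩ := exists_germ_eq _ s
  obtain ⟨W, hW, _, α, _, h⟩ := E.exists_represents e hx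
  exact ⟨α ⟨x, hW⟩, h ⟨x, hW⟩⟩

/-- The map `H'_x → ℂ ⊗ H'_x / F ^ 0 = ℂ ⊗ H_x / F ^ 0`. -/
def VHS.MixedExtension.toFiberModF0 (x : An S) : Stalk E.L x →+ Fiber H.L x ⧸ H.F0 x :=
  AddMonoidHom.mk' (fun s => QuotientAddGroup.mk (E.exists_represents_stalk x s).choose)
    fun s s' => QuotientAddGroup.eq_iff_sub_mem.mpr <|
      (E.exists_represents_stalk x (s + s')).choose_spec.sub_mem
        ((E.exists_represents_stalk x s).choose_spec.add
          (E.exists_represents_stalk x s').choose_spec)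

variable {E} in
-- The chosen representative may be replaced by any other, in particular by the values of a
-- holomorphic family.
lemma VHS.MixedExtension.Represents.toFiberModF0_eq {x : An S} {s : Stalk E.L x}
    {α : Fiber H.L x} (h : E.Represents x s α) :
    E.toFiberModF0 x s = QuotientAddGroup.mk α :=
  QuotientAddGroup.eq_iff_sub_mem.mpr ((E.exists_represents_stalk x s).choose_spec.sub_mem h)

/-- The morphism of sheaves `H'_ℤ → ℋ' / F ^ 0 ℋ' = ℋ / F ^ 0 ℋ`. -/
def VHS.MixedExtension.toModF0Sheaf : E.L ⟶ H.modF0Sheaf :=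
  ⟨{ app := fun U => AddCommGrpCat.ofHom
      { toFun := fun e => ⟨fun y => E.toFiberModF0 y (germ E.L y.1 y.2 e), fun x => by
          obtain ⟨W, hxW, hWU, α, hα, h⟩ := E.exists_represents e x.2
          exact ⟨W, hxW, hWU, α, hα, fun y => (h y).toFiberModF0_eq⟩⟩
        map_zero' := Subtype.ext (funext fun y => by simp)
        map_add' := fun a b => Subtype.ext (funext fun y => by simp) }
     naturality := fun U V i => by
      ext e
      refine Subtype.ext (funext fun y => ?_)
      exact congrArg (E.toFiberModF0 y)
        (TopCat.Presheaf.germ_res_apply E.L.obj i.unop y.1 y.2 e) }⟩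

/-- An integral element of `H` is represented by itself. This is the left square of the morphism of
sequences. -/
lemma VHS.MixedExtension.incl_toModF0Sheaf :
    E.incl ≫ E.toModF0Sheaf = toQuotientSheaf H.L H.F0 := by
  refine CategoryTheory.Sheaf.hom_ext ?_
  ext U e
  refine Subtype.ext (funext fun y => ?_)
  refine Eq.trans ?_ (E.represents_incl y (germ H.L y.1 y.2 e)).toFiberModF0_eq
  exact congrArg (E.toFiberModF0 y) (stalkMap_germ E.incl y.2 e).symm

lemma VHS.MixedExtension.incl_comp_toJacobianSheaf :
    E.incl ≫ E.toModF0Sheaf ≫ H.exponentialSequence.g = 0 :=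
  (Category.assoc _ _ _).symm.trans
    ((congrArg (· ≫ H.exponentialSequence.g) E.incl_toModF0Sheaf).trans H.exponentialSequence.zero)

/-- The morphism `ℤ → 𝒥(ℋ)` induced on cokernels. -/
def VHS.MixedExtension.toJacobianSheaf : constZ S ⟶ H.jacobianSheaf :=
  haveI := E.shortExact.epi_g
  E.shortExact.exact.desc (E.toModF0Sheaf ≫ H.exponentialSequence.g)
    E.incl_comp_toJacobianSheaf

lemma VHS.MixedExtension.proj_toJacobianSheaf :
    E.proj ≫ E.toJacobianSheaf = E.toModF0Sheaf ≫ H.exponentialSequence.g :=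
  haveI := E.shortExact.epi_g
  E.shortExact.exact.g_desc _ E.incl_comp_toJacobianSheaf

/-- The morphism from the sequence of local systems of an extension to the exponential
sequence. -/
def VHS.MixedExtension.toExponentialSequence :
    ShortComplex.mk E.incl E.proj E.zero ⟶ H.exponentialSequence where
  τ₁ := 𝟙 H.L
  τ₂ := E.toModF0Sheaf
  τ₃ := E.toJacobianSheaf
  comm₁₂ := (Category.id_comp _).trans E.incl_toModF0Sheaf.symm
  comm₂₃ := E.proj_toJacobianSheaf.symm

/-- The morphism `ℤ → 𝒥(ℋ)` of an extension attached to `ν` maps `1` to `ν`. -/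
lemma VHS.MixedExtension.toJacobianSheaf_constOne {ν : H.NormalFunction} (hν : E.IsAttachedTo ν) :
    E.toJacobianSheaf.hom.app (op ⊤) (constOne S) = ν := by
  refine Subtype.ext (funext fun ⟨x, _⟩ => ?_)
  obtain ⟨σ, α, hσ, hα, hx⟩ := hν x
  obtain ⟨U, hxU, s, rfl⟩ := exists_germ_eq _ σ
  rw [stalkMap_germ] at hσ
  -- On `W` the section `s` is a lift of `1`, so there the image of `1` in `𝒥(ℋ)` can be computed by
  -- sending `s` through `ℋ/F⁰ℋ`; at `x` the witness `α` represents `s`.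
  obtain ⟨W, hxW, i, j, hij⟩ := TopCat.Presheaf.germ_eq (constZ S).obj x hxU (Opens.mem_top x) _ _ hσ
  have h1 := ConcreteCategory.congr_hom (E.toJacobianSheaf.hom.naturality i.op)
    (E.proj.hom.app (op U) s)
  have h2 := ConcreteCategory.congr_hom (E.toJacobianSheaf.hom.naturality j.op) (constOne S)
  have h3 := congrArg (fun φ : E.L ⟶ H.jacobianSheaf => (φ.hom.app (op U)).hom s)
    E.proj_toJacobianSheaf
  have h4 := (h2.symm.trans ((congrArg (E.toJacobianSheaf.hom.app (op W)).hom hij.symm).trans h1))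
  have h5 := congrFun (congrArg Subtype.val h4) ⟨x, hxW⟩
  have h6 := congrFun (congrArg Subtype.val h3) ⟨x, hxU⟩
  refine (h5.trans h6).trans (Eq.trans ?_ hx.symm)
  exact congrArg (QuotientAddGroup.map (H.F0 x) (H.F0Lattice x) (AddMonoidHom.id _) le_sup_left)
    (VHS.MixedExtension.Represents.toFiberModF0_eq hα)

/-- Naturality is applied to `toExponentialSequence`, whose component on `H_ℤ` is the identity and
so acts trivially on `H¹`. -/
theorem VHS.MixedExtension.hodgeClass_eq_deltaOne (hexp : H.exponentialSequence.ShortExact)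
    {ν : H.NormalFunction} (hν : E.IsAttachedTo ν) : H.hodgeClass hexp ν = E.deltaOne := by
  have h := connectingMap_naturality E.shortExact hexp E.toExponentialSequence (constOne S)
  have h' : CategoryTheory.Sheaf.H.map (𝟙 H.L) 1 E.deltaOne =
      connectingMap hexp (E.toJacobianSheaf.hom.app (op ⊤) (constOne S)) := h
  rw [CategoryTheory.Sheaf.H.map_id_apply, E.toJacobianSheaf_constOne hν] at h'
  exact h'.symm

end MixedExtension

end NormalFunctions

end

theorem mainTheorem8
    (S : CategoryTheory.Over (AlgebraicGeometry.Spec (CommRingCat.of ℂ)))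
    [AlgebraicGeometry.IsIntegral S.left] [AlgebraicGeometry.IsSeparated S.hom]
    [AlgebraicGeometry.LocallyOfFiniteType S.hom] [AlgebraicGeometry.QuasiCompact S.hom]
    (H : NormalFunctions.VHS S (-1)) :
    ∃ hexp : H.exponentialSequence.ShortExact,
      ∀ (ν : H.NormalFunction) (E : H.MixedExtension),
        E.IsAttachedTo ν → H.hodgeClass hexp ν = E.deltaOne :=
  ⟨H.shortExact_exponentialSequence, fun _ E hν => E.hodgeClass_eq_deltaOne _ hν⟩
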